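/- Let $F$ be a field and let $n \ge 3$ be an integer. Let $I_n$ be the ideal of the polynomial ring $F[x_1,\dots,x_n]$ generated by the $n$ binomials $$x_1\cdots x_{i-1}x_{i+1}\cdots x_n - x_i \qquad (i = 1,\dots,n).$$ Then the set $$S_n = \{x_n^{2n-3}-x_n\} \cup \{x_k x_n^{2(n-2)} - x_k,\ x_k^2 - x_n^2 : 2 \le k \le n-1\} \cup \{x_1 - x_2x_3\cdots x_n\}$$ is a Gröbner basis of $I_n$ with respect to the lexicographic order with $x_1 > x_2 > \cdots > x_n$; that is, $S_n$ is a finite subset of $I_n$, and the leading terms of the elements of $S_n$ generate the ideal generated by the leading terms of all elements of $I_n$. -/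

import Mathlib

namespace LexGroebner

open MvPolynomial

/-- `G` is a Gröbner basis of the ideal `I` for the monomial order `m`: it is a finite subset of
`I` whose leading terms generate the ideal generated by the leading terms of all elements
of `I`. -/
def IsGroebnerBasis {σ F : Type*} [Field F] (m : MonomialOrder σ)
    (G : Set (MvPolynomial σ F)) (I : Ideal (MvPolynomial σ F)) : Prop :=
  G.Finite ∧ G ⊆ (I : Set (MvPolynomial σ F)) ∧
    Ideal.span (m.leadingTerm '' G) =
      Ideal.span (m.leadingTerm '' (I : Set (MvPolynomial σ F)))

/-- The ideal `I_n` of `F[x_1, …, x_n]` generated by the `n` binomials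
`x_1 ⋯ x_{i-1} x_{i+1} ⋯ x_n - x_i`. The variable `x_i` is `X i'` for the element `i'` of `Fin n`
with value `i - 1`. -/
noncomputable def binomialIdeal (F : Type*) [Field F] (n : ℕ) :
    Ideal (MvPolynomial (Fin n) F) :=
  Ideal.span (Set.range fun i : Fin n =>
    (∏ j ∈ Finset.univ.erase i, X j) - (X i : MvPolynomial (Fin n) F))

/-- The set `S_n`. The variable `x_1` is `X ⟨0, _⟩`, the variable `x_n` is `X ⟨n - 1, _⟩`, and the
variables `x_2, …, x_{n-1}` are the `X k` with `0 < k < n - 1`. -/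
noncomputable def basisSet (F : Type*) [Field F] (n : ℕ) (hn : 3 ≤ n) :
    Set (MvPolynomial (Fin n) F) :=
  let first : Fin n := ⟨0, by omega⟩
  let last : Fin n := ⟨n - 1, by omega⟩
  {X last ^ (2 * n - 3) - X last} ∪
    {p | ∃ k : Fin n, first < k ∧ k < last ∧
      (p = X k * X last ^ (2 * (n - 2)) - X k ∨ p = X k ^ 2 - X last ^ 2)} ∪
    {X first - ∏ j ∈ Finset.univ.erase first, X j}

end LexGroebner

namespace LexGroebner

open MvPolynomial

section Algebra

variable {F σ : Type*} [Field F]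

/-! Modulo the ideal every `x_i ^ 2` equals the product of all variables; this puts the basis inside
the ideal. Conversely, the generators are killed by sending each `x_i` to a group element of
`ℤ/2(n-2) × (ℤ/2)^n` in the group algebra, so within an element of the ideal the coefficients of
each degree sum to zero. A nonconstant monomial divisible by no leading term of the basis shares its
degree with no smaller nonconstant monomial, and elements of the ideal have no constant term. Hence
such a monomial cannot lead an element of the ideal. -/

/-- The leading term of a pure difference binomial is its larger monomial. -/
lemma leadingTerm_monomial_sub_monomial (m : MonomialOrder σ) {a b : σ →₀ ℕ}
    (h : m.toSyn b < m.toSyn a) :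
    m.leadingTerm (monomial a (1 : F) - monomial b 1) = monomial a 1 := by
  classical
  have hdeg : m.toSyn (m.degree (monomial b (1 : F))) <
      m.toSyn (m.degree (monomial a (1 : F))) := by
    simpa [MonomialOrder.degree_monomial] using h
  rw [MonomialOrder.leadingTerm, m.degree_sub_of_lt hdeg, m.leadingCoeff_sub_of_lt hdeg]
  simp [MonomialOrder.degree_monomial]

/-- If `f` is killed by grading the variables by `w` and collecting terms, then the coefficient of
any monomial which is alone in its degree vanishes. -/
lemma coeff_eq_zero_of_aeval_single_eq_zero [Fintype σ] {G : Type*} [AddCommMonoid G] (w : σ → G)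
    {f : MvPolynomial σ F}
    (hf : aeval (fun i => (AddMonoidAlgebra.single (w i) 1 : AddMonoidAlgebra F G)) f = 0)
    (d : σ →₀ ℕ) (hd : ∀ e ∈ f.support, ∑ i, e i • w i = ∑ i, d i • w i → e = d) :
    f.coeff d = 0 := by
  classical
  rw [aeval_def, eval₂_eq'] at hf
  have h := congrArg (fun p : AddMonoidAlgebra F G => p.coeff (∑ i, d i • w i)) hf
  simp only [AddMonoidAlgebra.single_pow, one_pow, AddMonoidAlgebra.prod_single,
    Finset.prod_const_one, AddMonoidAlgebra.coe_algebraMap, Function.comp_apply,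
    AddMonoidAlgebra.single_mul_single, zero_add, mul_one, AddMonoidAlgebra.coeff_sum,
    Finsupp.finsetSum_apply, AddMonoidAlgebra.coeff_single, Finsupp.single_apply] at h
  rw [Finset.sum_eq_single d (fun e he hne => if_neg fun hw => hne (hd e he hw))
    (fun hdf => by simpa using hdf)] at h
  simpa using h

variable {ι R : Type*} [Fintype ι] [DecidableEq ι] [CommRing R] {a : ι → R}

lemma sq_eq_prod_of_prod_erase_eq (h : ∀ i, ∏ j ∈ Finset.univ.erase i, a j = a i) (i : ι) :
    a i ^ 2 = ∏ j, a j := by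
  rw [← Finset.mul_prod_erase Finset.univ a (Finset.mem_univ i), h, sq]

/-- All squares agree, so the power of `a l` can be spread as one square over each index other than
`i` and `k`. Applying `h` at `i` and then at `k` absorbs these squares. -/
lemma mul_pow_eq_of_prod_erase_eq (h : ∀ i, ∏ j ∈ Finset.univ.erase i, a j = a i) {i k : ι}
    (hik : i ≠ k) (l : ι) : a k * a l ^ (2 * (Fintype.card ι - 2)) = a k := by
  have hi : i ∈ Finset.univ.erase k := Finset.mem_erase.2 ⟨hik, Finset.mem_univ i⟩
  have hk : k ∈ Finset.univ.erase i := Finset.mem_erase.2 ⟨hik.symm, Finset.mem_univ k⟩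
  have hsq : ∀ j, a j ^ 2 = a l ^ 2 := fun j => by
    rw [sq_eq_prod_of_prod_erase_eq h, sq_eq_prod_of_prod_erase_eq h]
  have hcard : ((Finset.univ.erase k).erase i).card = Fintype.card ι - 2 := by
    rw [Finset.card_erase_of_mem hi, Finset.card_erase_of_mem (Finset.mem_univ k),
      Finset.card_univ]
    omega
  calc a k * a l ^ (2 * (Fintype.card ι - 2))
      = a k * ∏ j ∈ (Finset.univ.erase k).erase i, a j ^ 2 := by
        rw [Finset.prod_congr rfl fun j _ => hsq j, Finset.prod_const, hcard, pow_mul]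
    _ = (a k * ∏ j ∈ (Finset.univ.erase i).erase k, a j) *
          ∏ j ∈ (Finset.univ.erase k).erase i, a j := by
        rw [Finset.prod_pow, Finset.erase_right_comm, sq, mul_assoc]
    _ = a k := by
        rw [Finset.mul_prod_erase _ _ hk, h, Finset.mul_prod_erase _ _ hi, h]

end Algebra

section Ideal

variable {F : Type*} [Field F] {n : ℕ}

lemma basisSet_subset_binomialIdeal (hn : 3 ≤ n) :
    basisSet F n hn ⊆ (binomialIdeal F n : Set (MvPolynomial (Fin n) F)) := by
  have h : ∀ i : Fin n, ∏ j ∈ Finset.univ.erase i, Ideal.Quotient.mk (binomialIdeal F n) (X j) =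
      Ideal.Quotient.mk (binomialIdeal F n) (X i) := fun i => by
    rw [← map_prod]
    exact Ideal.Quotient.eq.2 (Ideal.subset_span ⟨i, rfl⟩)
  have hpow := fun {i k : Fin n} (hik : i ≠ k) => mul_pow_eq_of_prod_erase_eq h hik
  rw [Fintype.card_fin] at hpow
  have h0 : (⟨0, by omega⟩ : Fin n) ≠ ⟨n - 1, by omega⟩ := by simp; omega
  rintro p ((rfl | ⟨k, hk, -, rfl | rfl⟩) | rfl)
  · refine Ideal.Quotient.eq.1 ?_
    -- This is the case where `k` and `l` are both the last index.
    rw [map_pow, show 2 * n - 3 = 2 * (n - 2) + 1 by omega, pow_succ']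
    exact hpow h0 _
  · refine Ideal.Quotient.eq.1 ?_
    rw [map_mul, map_pow]
    exact hpow hk.ne _
  · refine Ideal.Quotient.eq.1 ?_
    rw [map_pow, map_pow, sq_eq_prod_of_prod_erase_eq h, sq_eq_prod_of_prod_erase_eq h]
  · refine Ideal.Quotient.eq.1 ?_
    rw [map_prod, h]

lemma finite_basisSet (hn : 3 ≤ n) : (basisSet F n hn).Finite := by
  refine ((Set.finite_singleton _).union ?_).union (Set.finite_singleton _)
  refine ((Set.finite_range fun k : Fin n => X k * X ⟨n - 1, by omega⟩ ^ (2 * (n - 2)) - X k).union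
    (Set.finite_range fun k : Fin n => X k ^ 2 - X ⟨n - 1, by omega⟩ ^ 2)).subset ?_
  rintro p ⟨k, -, -, rfl | rfl⟩
  exacts [Or.inl ⟨k, rfl⟩, Or.inr ⟨k, rfl⟩]

/-- The degrees of the variables in `ℤ/2(n-2) × (ℤ/2)^n` for which the ideal is homogeneous. -/
def weight (n : ℕ) (i : Fin n) : ZMod (2 * (n - 2)) × (Fin n → ZMod 2) :=
  (if i.val = 0 then (n - 1 : ℕ) else 1,
    fun k => if 0 < k.val ∧ k.val < n - 1 ∧ (i = k ∨ i.val = 0) then 1 else 0)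

lemma two_nsmul_weight (hn : 3 ≤ n) (i : Fin n) : 2 • weight n i = (2, 0) := by
  have h : ((2 * (n - 2) : ℕ) : ZMod (2 * (n - 2))) = 0 := ZMod.natCast_self _
  refine Prod.ext ?_ (funext fun k => ?_)
  · rw [Prod.smul_fst, nsmul_eq_mul]
    by_cases hi : i.val = 0
    · simp only [weight, hi, if_true, ← Nat.cast_mul]
      rw [show 2 * (n - 1) = 2 * (n - 2) + 2 by omega, Nat.cast_add, h]
      simp
    · simp [weight, hi]
  · rw [Prod.smul_snd, Pi.smul_apply, nsmul_eq_mul, show ((2 : ℕ) : ZMod 2) = 0 from rfl,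
      zero_mul]
    rfl

lemma sum_weight (hn : 3 ≤ n) : ∑ i, weight n i = (2, 0) := by
  have h : ((2 * (n - 2) : ℕ) : ZMod (2 * (n - 2))) = 0 := ZMod.natCast_self _
  obtain ⟨m, rfl⟩ : ∃ m, n = m + 1 := ⟨n - 1, by omega⟩
  ext k
  · rw [Prod.fst_sum, Fin.sum_univ_succ]
    simp only [weight, Fin.val_zero, if_true, Fin.val_succ, Nat.succ_ne_zero, if_false,
      Finset.sum_const, Finset.card_univ, Fintype.card_fin, nsmul_eq_mul, mul_one,
      ← Nat.cast_add]
    rw [show m + 1 - 1 + m = 2 * (m + 1 - 2) + 2 by omega, Nat.cast_add, h]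
    simp
  · rw [Prod.snd_sum, Finset.sum_apply, Fin.sum_univ_succ]
    by_cases hk : 0 < k.val ∧ k.val < m
    · obtain ⟨j, rfl⟩ : ∃ j : Fin m, k = j.succ :=
        ⟨k.pred (fun h0 => by simp [h0] at hk), by simp⟩
      have h2 : (1 : ZMod 2) + 1 = 0 := rfl
      simp only [Fin.val_succ] at hk
      simp [weight, hk, h2]
    · have h0 : ∀ i, (weight (m + 1) i).2 k = 0 := fun i => if_neg fun hi => hk ⟨hi.1, hi.2.1⟩
      simp [h0]

/-- The total weight is twice each single weight, so cancelling `weight n i` shows that the two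
monomials of a generator have the same degree. -/
lemma aeval_weight_eq_zero (hn : 3 ≤ n) {f : MvPolynomial (Fin n) F}
    (hf : f ∈ binomialIdeal F n) :
    aeval (fun i => (AddMonoidAlgebra.single (weight n i) 1 : AddMonoidAlgebra F _)) f = 0 := by
  refine (Ideal.span_le (I := RingHom.ker (aeval (R := F) (fun i =>
    (AddMonoidAlgebra.single (weight n i) 1 : AddMonoidAlgebra F _))))).2 ?_ hf
  rintro _ ⟨i, rfl⟩
  simp only [SetLike.mem_coe, RingHom.mem_ker, map_sub, map_prod, aeval_X,
    AddMonoidAlgebra.prod_single, Finset.prod_const_one]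
  rw [sub_eq_zero]
  congr 1
  have := Finset.add_sum_erase Finset.univ (weight n) (Finset.mem_univ i)
  rw [sum_weight hn, ← two_nsmul_weight hn i, two_nsmul] at this
  exact add_left_cancel this

/-- Needed because the grading cannot separate `1` from `x_n ^ (2 * (n - 2))`. -/
lemma coeff_zero_eq_zero (hn : 3 ≤ n) {f : MvPolynomial (Fin n) F}
    (hf : f ∈ binomialIdeal F n) : f.coeff 0 = 0 := by
  refine (Ideal.span_le (I := RingHom.ker (constantCoeff (R := F)))).2 ?_ hf
  rintro _ ⟨i, rfl⟩
  have hcard : (Finset.univ.erase i).card ≠ 0 := by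
    rw [Finset.card_erase_of_mem (Finset.mem_univ i), Finset.card_univ, Fintype.card_fin]
    omega
  simp only [SetLike.mem_coe, RingHom.mem_ker, map_sub, map_prod, constantCoeff_X,
    Finset.prod_const, zero_pow hcard, sub_zero]

/-- A nonzero exponent that is at most a standard one and has the same degree is equal to it. -/
lemma eq_of_sum_weight_eq (hn : 3 ≤ n) {first last : Fin n} (h0 : first.val = 0)
    (hl : last.val = n - 1) {d e : Fin n →₀ ℕ}
    (hfirst : d first = 0)
    (hmid : ∀ k : Fin n, 0 < k.val → k.val < n - 1 →
      d k < 2 ∧ (0 < d k → d last < 2 * (n - 2)))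
    (hlast : d last ≤ 2 * (n - 2))
    (he : e ≠ 0) (hle : toLex e ≤ toLex d)
    (hw : ∑ i, e i • weight n i = ∑ i, d i • weight n i) : e = d := by
  by_contra hne
  obtain ⟨i, hlt, hi⟩ := Finsupp.Lex.lt_iff.1 (lt_of_le_of_ne hle fun h => hne (toLex_inj.1 h))
  simp only [ofLex_toLex] at hlt hi
  have hi0 : i.val ≠ 0 := fun h => by
    obtain rfl : first = i := Fin.ext (h0.trans h.symm)
    omega
  have hefirst : e first = 0 := by
    rw [hlt _ (Fin.lt_def.2 (by omega)), hfirst]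
  -- At a middle index, the matching `ℤ/2` coordinate records the parity of the exponent, which
  -- rules out `e i < d i < 2`.
  by_cases hilast : i.val < n - 1
  · have key : ∀ c : Fin n →₀ ℕ, c first = 0 → (∑ j, c j • weight n j).2 i = c i := by
      intro c hc
      rw [Prod.snd_sum, Finset.sum_apply, Finset.sum_eq_single i]
      · simp [weight, hilast, Nat.pos_of_ne_zero hi0]
      · intro j _ hji
        by_cases hj : j.val = 0
        · obtain rfl : first = j := Fin.ext (h0.trans hj.symm)
          simp [hc]
        · simp [weight, hji, hj]
      · simp
    have h := congrArg (fun x => x.2 i) hw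
    simp only [key e hefirst, key d hfirst] at h
    rw [ZMod.natCast_eq_natCast_iff'] at h
    have := hmid i (by omega) hilast
    omega
  -- The exponents differ only at the last variable, and total degree modulo `2 * (n - 2)` leaves
  -- only the pair `0` and `2 * (n - 2)`. Then `hmid` makes the middle exponents vanish, forcing `e
  -- = 0`.
  · obtain rfl : last = i := Fin.ext (by omega)
    have key : ∀ c : Fin n →₀ ℕ, c first = 0 →
        (∑ j, c j • weight n j).1 = (∑ j, c j : ℕ) := by
      intro c hc
      rw [Prod.fst_sum, Nat.cast_sum]
      refine Finset.sum_congr rfl fun j _ => ?_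
      by_cases hj : j.val = 0
      · obtain rfl : first = j := Fin.ext (h0.trans hj.symm)
        simp [hc]
      · simp [weight, hj]
    have h := congrArg Prod.fst hw
    rw [key e hefirst, key d hfirst, ← Finset.add_sum_erase _ _ (Finset.mem_univ last),
      ← Finset.add_sum_erase _ (⇑d) (Finset.mem_univ last)] at h
    have hlt' : ∀ j : Fin n, j ≠ last → e j = d j := fun j hj =>
      hlt j (Fin.lt_def.2 (by have := Fin.val_ne_of_ne hj; omega))
    rw [Finset.sum_congr rfl fun j hj => hlt' j (Finset.ne_of_mem_erase hj), Nat.cast_add,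
      Nat.cast_add, add_left_inj, ZMod.natCast_eq_natCast_iff'] at h
    have hdlast : d last = 2 * (n - 2) := by
      by_contra hlt2
      rw [Nat.mod_eq_of_lt (by omega), Nat.mod_eq_of_lt (by omega)] at h
      omega
    have helast : e last = 0 := by
      rw [hdlast, Nat.mod_self, Nat.mod_eq_of_lt (by omega)] at h
      exact h
    refine he (Finsupp.ext fun j => ?_)
    by_cases hj : j = last
    · rw [hj, helast, Finsupp.zero_apply]
    · rw [hlt' j hj, Finsupp.zero_apply]
      by_cases hj0 : j.val = 0
      · rwa [show j = first from Fin.ext (hj0.trans h0.symm)]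
      · have := hmid j (by omega) (by have := Fin.val_ne_of_ne hj; omega)
        omega

/-- The leading monomial of a nonzero element of the ideal is divisible by the leading term of an
element of `basisSet F n hn`. -/
lemma exists_le_of_mem_binomialIdeal (hn : 3 ≤ n) {f : MvPolynomial (Fin n) F}
    (hf : f ∈ binomialIdeal F n) (hf0 : f ≠ 0) :
    ∃ e ≤ MonomialOrder.lex.degree f,
      monomial e 1 ∈ MonomialOrder.lex.leadingTerm '' basisSet F n hn := by
  classical
  have hX : ∀ i : Fin n, (X i : MvPolynomial (Fin n) F) = monomial (Finsupp.single i 1) 1 :=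
    fun _ => rfl
  -- Each bound on the leading exponent below comes from one family of leading terms failing to
  -- divide it.
  by_contra! hstd
  refine MonomialOrder.lex.coeff_degree_ne_zero_iff.2 hf0
    (coeff_eq_zero_of_aeval_single_eq_zero (weight n) (aeval_weight_eq_zero hn hf) _
      fun e he hw => eq_of_sum_weight_eq hn (first := ⟨0, by omega⟩)
        (last := ⟨n - 1, by omega⟩) rfl rfl ?_ ?_ ?_ ?_ (MonomialOrder.lex.le_degree he) hw)
  · by_contra h
    refine hstd (Finsupp.single ⟨0, by omega⟩ 1) (Finsupp.single_le_iff.2 (by omega))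
      ⟨_, Or.inr rfl, ?_⟩
    simp only [hX, ← monomial_sum_one]
    refine leadingTerm_monomial_sub_monomial _ (MonomialOrder.lex_lt_iff.2
      (Finsupp.Lex.lt_iff.2 ⟨⟨0, by omega⟩, fun j hj => absurd hj (Nat.not_lt_zero _), ?_⟩))
    simp [Finsupp.single_apply]
  · intro k hk hkn
    have hkne : k ≠ ⟨n - 1, by omega⟩ := Fin.ne_of_val_ne hkn.ne
    refine ⟨?_, fun hdk => ?_⟩
    · by_contra h
      refine hstd (Finsupp.single k 2) (Finsupp.single_le_iff.2 (by omega))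
        ⟨_, Or.inl (Or.inr ⟨k, hk, hkn, Or.inr rfl⟩), ?_⟩
      simp only [X_pow_eq_monomial]
      refine leadingTerm_monomial_sub_monomial _ (MonomialOrder.lex_lt_iff.2
        (Finsupp.Lex.lt_iff.2 ⟨k, fun j hj => ?_, ?_⟩))
      · have : (⟨n - 1, by omega⟩ : Fin n) ≠ j := (hj.trans (Fin.lt_def.2 hkn)).ne'
        simp [hj.ne', this]
      · simp [hkne.symm]
    · by_contra h
      refine hstd (Finsupp.single k 1 + Finsupp.single ⟨n - 1, by omega⟩ (2 * (n - 2)))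
        (fun j => ?_) ⟨_, Or.inl (Or.inr ⟨k, hk, hkn, Or.inl rfl⟩), ?_⟩
      · simp only [Finsupp.add_apply, Finsupp.single_apply]
        split_ifs with h1 h2 h2
        · exact absurd (h1.trans h2.symm) hkne
        · subst h1; omega
        · subst h2; omega
        · omega
      · simp only [hX, monomial_pow, Finsupp.smul_single, smul_eq_mul, one_pow, monomial_mul,
          mul_one]
        refine leadingTerm_monomial_sub_monomial _ (MonomialOrder.lex_lt_iff.2
          (Finsupp.Lex.lt_iff.2 ⟨⟨n - 1, by omega⟩, fun j hj => ?_, ?_⟩))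
        · simp [Finsupp.single_apply, hj.ne']
        · simp [hkne]; omega
  · by_contra h
    refine hstd (Finsupp.single ⟨n - 1, by omega⟩ (2 * n - 3)) (Finsupp.single_le_iff.2 (by omega))
      ⟨_, Or.inl (Or.inl rfl), ?_⟩
    simp only [hX, monomial_pow, Finsupp.smul_single, smul_eq_mul, one_pow, mul_one]
    refine leadingTerm_monomial_sub_monomial _ (MonomialOrder.lex_lt_iff.2
      (Finsupp.Lex.lt_iff.2 ⟨⟨n - 1, by omega⟩, fun j hj => ?_, ?_⟩))
    · simp [hj.ne']
    · simp; omega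
  · rintro rfl
    exact mem_support_iff.1 he (coeff_zero_eq_zero hn hf)

end Ideal

end LexGroebner

theorem mainTheorem10 (F : Type*) [Field F] (n : ℕ) (hn : 3 ≤ n) :
    LexGroebner.IsGroebnerBasis (MonomialOrder.lex (σ := Fin n))
      (LexGroebner.basisSet F n hn) (LexGroebner.binomialIdeal F n) := by
  have hsub := LexGroebner.basisSet_subset_binomialIdeal (F := F) hn
  refine ⟨LexGroebner.finite_basisSet hn, hsub,
    le_antisymm (Ideal.span_mono (Set.image_mono hsub)) (Ideal.span_le.2 ?_)⟩
  rintro _ ⟨f, hf, rfl⟩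
  by_cases hf0 : f = 0
  · simp [hf0]
  obtain ⟨e, hle, he⟩ := LexGroebner.exists_le_of_mem_binomialIdeal hn hf hf0
  rw [MonomialOrder.leadingTerm, ← tsub_add_cancel_of_le hle,
    ← mul_one (MonomialOrder.lex.leadingCoeff f), ← MvPolynomial.monomial_mul]
  exact Ideal.mul_mem_left _ _ (Ideal.subset_span he)
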